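/- Let $\mathcal F^2(\mathbb C)$ be the Fock space of entire functions that are square integrable with respect to the Gaussian measure $\frac1\pi e^{-|z|^2}\,dV(z)$ on $\mathbb C$, with the inner product $\langle f,g\rangle=\frac1\pi\int_{\mathbb C}f(z)\overline{g(z)}e^{-|z|^2}\,dV(z)$. For complex numbers $a,b,c$ with $|a|=1$, $\bar a b+\bar b=0$ and $|c|^2e^{|b|^2}=1$, let $\mathcal C_{a,b,c}$ be the weighted composition conjugation on $\mathcal F^2(\mathbb C)$, $$\mathcal C_{a,b,c}f(z)=c\,e^{bz}\,\overline{f\left(\overline{az+b}\right)}.$$ On $L^2(\mathbb R)$ let $\mathcal Tf(x)=\overline{f(x)}$ and $\mathcal{PT}f(x)=\overline{f(-x)}$. Let $U$ be the Segal–Bargmann transform $$Uf(z)=\int_{\mathbb R}A(z,x)f(x)\,dx,\qquad A(z,x)=\pi^{-1/4}e^{(-z^2+2\sqrt2\,xz-x^2)/2},\qquad f\in L^2(\mathbb R),\ z\in\mathbb C.$$ Then $U$ is a unitary operator from $L^2(\mathbb R)$ onto $\mathcal F^2(\mathbb C)$, and the following identities hold on $\mathcal F^2(\mathbb C)$: $$U\,\mathcal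 T\,U^{-1}=\mathcal C_{1,0,1},\qquad U\,\mathcal{PT}\,U^{-1}=\mathcal C_{-1,0,1}.$$ -/

import Mathlib

open MeasureTheory
open scoped ComplexConjugate ENNReal

noncomputable section

/-! ### Fock space -/

/-- The Gaussian measure `π⁻¹ e^{-|z|²} dV(z)` on the complex plane, `dV` the Lebesgue measure. -/
def fockMeasure : Measure ℂ :=
  volume.withDensity fun z => ENNReal.ofReal (Real.pi⁻¹ * Real.exp (-‖z‖ ^ 2))

/-- The vector space of entire functions that are square integrable for the Gaussian measure. -/
def fockSubmodule : Submodule ℂ (ℂ → ℂ) where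
  carrier := {f | Differentiable ℂ f ∧ MemLp f 2 fockMeasure}
  add_mem' hf hg := ⟨hf.1.add hg.1, hf.2.add hg.2⟩
  zero_mem' := ⟨differentiable_const 0, MemLp.zero⟩
  smul_mem' c _ hf := ⟨hf.1.const_smul c, hf.2.const_smul c⟩

/-- The Fock space `ℱ²(ℂ)`. It is a separate type, so that its topology is the one of its inner
product and not that of pointwise convergence. -/
def FockSpace : Type := fockSubmodule

namespace FockSpace

instance : AddCommGroup FockSpace := inferInstanceAs (AddCommGroup fockSubmodule)

instance : Module ℂ FockSpace := inferInstanceAs (Module ℂ fockSubmodule)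

instance : FunLike FockSpace ℂ ℂ where
  coe f := f.1
  coe_injective _ _ h := Subtype.ext h

/-- An element of Fock space from an entire, square integrable function. -/
def mk (f : ℂ → ℂ) (hd : Differentiable ℂ f) (hf : MemLp f 2 fockMeasure) : FockSpace :=
  ⟨f, hd, hf⟩

@[simp] theorem mk_apply (f : ℂ → ℂ) (hd : Differentiable ℂ f) (hf : MemLp f 2 fockMeasure)
    (z : ℂ) : mk f hd hf z = f z := rfl

@[simp] theorem add_apply (f g : FockSpace) (z : ℂ) : (f + g) z = f z + g z := rfl

@[simp] theorem smul_apply (c : ℂ) (f : FockSpace) (z : ℂ) : (c • f) z = c * f z := rfl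

@[simp] theorem zero_apply (z : ℂ) : (0 : FockSpace) z = 0 := rfl

theorem differentiable (f : FockSpace) : Differentiable ℂ f := f.2.1

theorem memLp (f : FockSpace) : MemLp f 2 fockMeasure := f.2.2

theorem integrable_conj_mul (f g : FockSpace) :
    Integrable (fun z => conj (f z) * g z) fockMeasure :=
  f.memLp.star.integrable_mul g.memLp

theorem volume_absolutelyContinuous_fockMeasure : (volume : Measure ℂ) ≪ fockMeasure := by
  refine withDensity_absolutelyContinuous' (by fun_prop) (Filter.Eventually.of_forall fun z => ?_)
  have : 0 < Real.pi⁻¹ * Real.exp (-‖z‖ ^ 2) := by positivity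
  simpa using this

/-- The inner product `⟨f, g⟩ = π⁻¹ ∫ f(z) conj(g(z)) e^{-|z|²} dV(z)` of Fock space, in the
convention of Mathlib (conjugate-linear in the left slot). -/
@[reducible]
def innerCore : InnerProductSpace.Core ℂ FockSpace where
  inner f g := ∫ z, conj (f z) * g z ∂fockMeasure
  conj_inner_symm f g := by
    rw [← integral_conj]
    simp [mul_comm]
  re_inner_nonneg f := by
    have h : (fun z => conj (f z) * f z) = fun z => ((‖f z‖ ^ 2 : ℝ) : ℂ) := by
      funext z
      simp [Complex.conj_mul']
    rw [h, integral_complex_ofReal]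
    exact integral_nonneg fun z => by positivity
  add_left f g h := by
    simp only [add_apply, map_add, add_mul]
    exact integral_add (integrable_conj_mul f h) (integrable_conj_mul g h)
  smul_left f g r := by
    simp only [smul_apply, map_mul, mul_assoc]
    exact integral_const_mul _ _
  definite f hf := by
    have h : (fun z => conj (f z) * f z) = fun z => ((‖f z‖ ^ 2 : ℝ) : ℂ) := by
      funext z
      simp [Complex.conj_mul']
    change ∫ z, conj (f z) * f z ∂fockMeasure = 0 at hf
    have hi : Integrable (fun z => ‖f z‖ ^ 2) fockMeasure := f.memLp.integrable_norm_pow two_ne_zero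
    rw [h, integral_complex_ofReal, Complex.ofReal_eq_zero,
      integral_eq_zero_iff_of_nonneg (fun z => by positivity) hi] at hf
    have h0 := volume_absolutelyContinuous_fockMeasure.ae_le hf
    have h1 : (fun z => ‖f z‖ ^ 2) = fun _ => (0 : ℝ) :=
      (f.differentiable.continuous.norm.pow 2).ae_eq_iff_eq volume continuous_const |>.1 h0
    refine DFunLike.ext _ _ fun z => ?_
    simpa using congrFun h1 z

instance : NormedAddCommGroup FockSpace :=
  @InnerProductSpace.Core.toNormedAddCommGroup ℂ FockSpace _ _ _ innerCore

instance : InnerProductSpace ℂ FockSpace :=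
  InnerProductSpace.ofCore innerCore.toCore

theorem inner_def (f g : FockSpace) : inner ℂ f g = ∫ z, conj (f z) * g z ∂fockMeasure := rfl

end FockSpace

/-! ### Weighted composition conjugations on Fock space -/

/-- The condition on the complex parameters under which the anti-linear weighted composition
operator is a conjugation on Fock space. -/
def IsConjugationParam (a b c : ℂ) : Prop :=
  ‖a‖ = 1 ∧ conj a * b + conj b = 0 ∧ ‖c‖ ^ 2 * Real.exp (‖b‖ ^ 2) = 1

theorem isConjugationParam_one : IsConjugationParam 1 0 1 := by
  simp [IsConjugationParam]

theorem isConjugationParam_neg_one : IsConjugationParam (-1) 0 1 := by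
  simp [IsConjugationParam]

theorem measurePreserving_conj_affine {a : ℂ} (b : ℂ) (ha : ‖a‖ = 1) :
    MeasurePreserving (fun z : ℂ => conj (a * z + b)) := by
  have h1 := (rotation ⟨a, by simp [Submonoid.unitSphere, ha]⟩).measurePreserving
  have h2 := measurePreserving_add_right (volume : Measure ℂ) b
  have h3 := Complex.conjLIE.measurePreserving
  exact h3.comp (h2.comp h1)

theorem memLp_fockMeasure_iff {f : ℂ → ℂ} (hf : Continuous f) :
    MemLp f 2 fockMeasure ↔
      Integrable fun z => ‖f z‖ ^ 2 * (Real.pi⁻¹ * Real.exp (-‖z‖ ^ 2)) := by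
  rw [memLp_two_iff_integrable_sq_norm hf.aestronglyMeasurable, fockMeasure,
    integrable_withDensity_iff (by fun_prop) (by simp)]
  refine integrable_congr (Filter.Eventually.of_forall fun z => ?_)
  have : 0 ≤ Real.pi⁻¹ * Real.exp (-‖z‖ ^ 2) := by positivity
  simp only [ENNReal.toReal_ofReal this]

theorem IsConjugationParam.weight {a b c : ℂ} (h : IsConjugationParam a b c) (z : ℂ) :
    ‖c * Complex.exp (b * z)‖ ^ 2 * Real.exp (-‖z‖ ^ 2) = Real.exp (-‖conj (a * z + b)‖ ^ 2) := by
  obtain ⟨ha, hab, hc⟩ := h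
  have haa : a * conj a = 1 := by simp [Complex.mul_conj', ha]
  have hb : a * conj b = -b := by linear_combination a * hab - b * haa
  have hn : ‖a * z + b‖ ^ 2 = ‖z‖ ^ 2 + ‖b‖ ^ 2 - 2 * (b * z).re := by
    have e : (a * z) * conj b = -(b * z) := by linear_combination z * hb
    rw [Complex.sq_norm, Complex.normSq_add, e, ← Complex.sq_norm, ← Complex.sq_norm, norm_mul, ha]
    simp
    ring
  rw [RCLike.norm_conj, hn, norm_mul, Complex.norm_exp, mul_pow, ← Real.exp_nat_mul]
  have hc' : ‖c‖ ^ 2 = Real.exp (-‖b‖ ^ 2) := by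
    rw [Real.exp_neg]
    exact eq_inv_of_mul_eq_one_left hc
  rw [hc', ← Real.exp_add, ← Real.exp_add]
  congr 1
  push_cast
  ring

/-- The weighted composition conjugation
`𝒞_{a,b,c} f (z) = c e^{bz} conj (f (conj (a z + b)))` as a map of Fock space to itself. -/
def weightedCompConj (a b c : ℂ) (h : IsConjugationParam a b c) (f : FockSpace) : FockSpace :=
  FockSpace.mk (fun z => c * Complex.exp (b * z) * conj (f (conj (a * z + b))))
    (by
      have h1 : Differentiable ℂ fun w : ℂ => conj (f (conj w)) := by
        intro w
        have := (f.differentiable (conj w)).conj_conj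
        simpa [Function.comp_def] using this
      have h2 : Differentiable ℂ fun z : ℂ => a * z + b := by fun_prop
      have h3 : Differentiable ℂ fun z : ℂ => c * Complex.exp (b * z) := by fun_prop
      exact h3.mul (h1.comp h2))
    (by
      have hf := f.differentiable.continuous
      have hcont : Continuous fun z : ℂ =>
          c * Complex.exp (b * z) * conj (f (conj (a * z + b))) := by fun_prop
      rw [memLp_fockMeasure_iff hcont]
      have h1 := (memLp_fockMeasure_iff hf).1 f.memLp
      have h2 := (measurePreserving_conj_affine b h.1).integrable_comp_of_integrable h1
      refine h2.congr (Filter.Eventually.of_forall fun z => ?_)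
      simp only [Function.comp_apply]
      rw [← h.weight z, norm_mul (c * Complex.exp (b * z)), RCLike.norm_conj]
      ring)

/-! ### The Segal–Bargmann transform and the two conjugations on `L²(ℝ)` -/

/-- The kernel `A(z, x) = π^{-1/4} e^{(-z² + 2√2 x z - x²)/2}`. -/
def segalBargmannKernel (z : ℂ) (x : ℝ) : ℂ :=
  ((Real.pi ^ (-(1 / 4) : ℝ) : ℝ) : ℂ) *
    Complex.exp ((-z ^ 2 + 2 * (Real.sqrt 2 : ℂ) * (x : ℂ) * z - (x : ℂ) ^ 2) / 2)

/-- The function `z ↦ ∫ A(z, x) f(x) dx` on the complex plane. -/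
def segalBargmann (f : Lp ℂ 2 (volume : Measure ℝ)) (z : ℂ) : ℂ :=
  ∫ x : ℝ, segalBargmannKernel z x * f x

/-- The time-reversal operator `f ↦ conj (f (x))` on `L²(ℝ)`. -/
def timeReversal (f : Lp ℂ 2 (volume : Measure ℝ)) : Lp ℂ 2 (volume : Measure ℝ) := star f

/-- The operator `f ↦ conj (f (-x))` on `L²(ℝ)`. -/
def parityTime (f : Lp ℂ 2 (volume : Measure ℝ)) : Lp ℂ 2 (volume : Measure ℝ) :=
  star (Lp.compMeasurePreserving (fun x : ℝ => -x) (Measure.measurePreserving_neg volume) f)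

theorem timeReversal_ae (f : Lp ℂ 2 (volume : Measure ℝ)) :
    ∀ᵐ x, timeReversal f x = conj (f x) :=
  Lp.coeFn_star f

theorem parityTime_ae (f : Lp ℂ 2 (volume : Measure ℝ)) :
    ∀ᵐ x, parityTime f x = conj (f (-x)) := by
  have hm := Measure.measurePreserving_neg (volume : Measure ℝ)
  filter_upwards [Lp.coeFn_star (Lp.compMeasurePreserving (fun x : ℝ => -x) hm f),
    Lp.coeFn_compMeasurePreserving f hm] with x h1 h2
  change (star (Lp.compMeasurePreserving (fun x : ℝ => -x) hm f) : Lp ℂ 2 volume) x = _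
  rw [h1, Pi.star_apply, h2]
  rfl

theorem weightedCompConj_apply (a b c : ℂ) (h : IsConjugationParam a b c) (f : FockSpace) (z : ℂ) :
    weightedCompConj a b c h f z = c * Complex.exp (b * z) * conj (f (conj (a * z + b))) := rfl

end

/-!
The functions `k_w = conj (A(w, ·))` of `L²(ℝ)` and the reproducing kernels `K_w(z) = e^{z conj w}`
of Fock space have the same Gram matrix: `⟨k_w, k_z⟩ = ∫ A(w, x) conj (A(z, x)) dx = e^{w conj z}`
is a Gaussian integral, and `⟨K_w, K_z⟩ = K_z(w)`. Both families are total. A vector orthogonal to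
all `K_w` vanishes at every point, and on the imaginary axis `w ↦ ⟨k_w, f⟩` is, up to a nowhere
zero factor, the Fourier transform of `e^{-x²/2} f`. Hence `k_w ↦ K_w` extends to a unitary `U`, and
`U f (z) = ⟨K_z, U f⟩ = ⟨U k_z, U f⟩ = ⟨k_z, f⟩ = ∫ A(z, x) f(x) dx`. The two conjugations are then
read off from `conj (A(z, x)) = A(conj z, x)` and `A(z, -x) = A(-z, x)`.

The reproducing property at `0` is the mean value property averaged over circles; translating by
`w` moves it to `w`, because
`e^{-|z + w|²} conj (e^{(z + w) conj w}) = e^{-|z|²} e^{-z conj w}`.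
-/

open Filter Metric Topology
open scoped ContDiff FourierTransform InnerProductSpace SchwartzMap

section HilbertSpace

variable {𝕜 ι E F : Type*} [RCLike 𝕜] [NormedAddCommGroup E] [InnerProductSpace 𝕜 E]
  [NormedAddCommGroup F] [InnerProductSpace 𝕜 F] {u : ι → E} {v : ι → F}

theorem inner_linearCombination_eq_of_inner_eq (h : ∀ i j, ⟪u i, u j⟫_𝕜 = ⟪v i, v j⟫_𝕜)
    (a b : ι →₀ 𝕜) :
    ⟪Finsupp.linearCombination 𝕜 u a, Finsupp.linearCombination 𝕜 u b⟫_𝕜 =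
      ⟪Finsupp.linearCombination 𝕜 v a, Finsupp.linearCombination 𝕜 v b⟫_𝕜 := by
  simp only [Finsupp.linearCombination_apply, Finsupp.sum_inner, Finsupp.inner_sum,
    inner_smul_left, inner_smul_right, h]

theorem denseRange_linearCombination_of_inner_eq_zero [CompleteSpace E]
    (hu : ∀ x, (∀ i, ⟪u i, x⟫_𝕜 = 0) → x = 0) :
    DenseRange (Finsupp.linearCombination 𝕜 u) := by
  rw [DenseRange, ← LinearMap.coe_range, Submodule.dense_iff_topologicalClosure_eq_top,
    Submodule.topologicalClosure_eq_top_iff, Submodule.eq_bot_iff]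
  exact fun x hx => hu x fun i => (Submodule.mem_orthogonal _ _).1 hx _
    ⟨Finsupp.single i 1, by simp⟩

theorem exists_linearIsometryEquiv_of_inner_eq [CompleteSpace E] [CompleteSpace F]
    (hu : ∀ x, (∀ i, ⟪u i, x⟫_𝕜 = 0) → x = 0) (hv : ∀ y, (∀ i, ⟪v i, y⟫_𝕜 = 0) → y = 0)
    (h : ∀ i j, ⟪u i, u j⟫_𝕜 = ⟪v i, v j⟫_𝕜) :
    ∃ U : E ≃ₗᵢ[𝕜] F, ∀ i, U (u i) = v i := by
  have h_norm (a : ι →₀ 𝕜) :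
      ‖Finsupp.linearCombination 𝕜 v a‖ = ‖Finsupp.linearCombination 𝕜 u a‖ := by
    rw [norm_eq_sqrt_re_inner (𝕜 := 𝕜), norm_eq_sqrt_re_inner (𝕜 := 𝕜),
      inner_linearCombination_eq_of_inner_eq h]
  have hu' := denseRange_linearCombination_of_inner_eq_zero hu
  have hv' := denseRange_linearCombination_of_inner_eq_zero hv
  refine ⟨(LinearEquiv.refl 𝕜 (ι →₀ 𝕜)).extendOfIsometry _ _ hu' hv' h_norm, fun i => ?_⟩
  simpa using LinearEquiv.extendOfIsometry_eq (LinearEquiv.refl 𝕜 (ι →₀ 𝕜)) _ _ hu' hv' h_norm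
    (Finsupp.single i 1)

end HilbertSpace

section Fourier

variable {V E : Type*} [NormedAddCommGroup V] [InnerProductSpace ℝ V] [FiniteDimensional ℝ V]
  [MeasurableSpace V] [BorelSpace V] [NormedAddCommGroup E] [NormedSpace ℂ E] [CompleteSpace E]

theorem integral_schwartz_fourier_smul_eq {f : V → E} (hf : Integrable f) (φ : 𝓢(V, ℂ)) :
    ∫ x, 𝓕 φ x • f x = ∫ ξ, φ ξ • 𝓕 f ξ := by
  simpa using! VectorFourier.integral_bilin_fourierIntegral_eq_flip (.lsmul ℂ ℂ) (L := innerₗ V)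
    Real.continuous_fourierChar continuous_inner φ.integrable hf

theorem ae_eq_zero_of_fourier_eq_zero {f : V → E} (hf : Integrable f) (h : 𝓕 f = 0) :
    f =ᵐ[volume] 0 := by
  refine ae_eq_zero_of_integral_contDiff_smul_eq_zero hf.locallyIntegrable fun g hg hgc => ?_
  have hgc' : HasCompactSupport (Complex.ofRealCLM ∘ g) := hgc.comp_left rfl
  have hψ := integral_schwartz_fourier_smul_eq hf
    (𝓕⁻ (hgc'.toSchwartzMap (by fun_prop) : 𝓢(V, ℂ)))
  simpa [h] using hψ

end Fourier

section MeanValue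

variable {E : Type*} [NormedAddCommGroup E] [NormedSpace ℝ E]

theorem circleAverage_comp_exp_mul (f : ℂ → E) (z : ℂ) :
    (2 * Real.pi)⁻¹ • ∫ θ in 0..2 * Real.pi, f (Circle.exp θ * z) =
      Real.circleAverage f 0 ‖z‖ := by
  rw [Real.circleAverage_eq_integral_add z.arg]
  congr! 4 with θ
  conv_lhs => rw [← Complex.norm_mul_exp_arg_mul_I z]
  simp only [circleMap, zero_add, Circle.coe_exp]
  push_cast
  rw [add_mul, Complex.exp_add]
  ring

theorem integral_circleAverage_norm [CompleteSpace E] {μ : Measure ℂ} [SFinite μ]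
    (hμ : ∀ a : Circle, MeasurePreserving (rotation a) μ μ) {f : ℂ → E} (hf : Integrable f μ) :
    ∫ z, Real.circleAverage f 0 ‖z‖ ∂μ = ∫ z, f z ∂μ := by
  have hrot (θ : ℝ) : ∫ z, f (Circle.exp θ * z) ∂μ = ∫ z, f z ∂μ := by
    simpa using (hμ (Circle.exp θ)).integral_comp
      (rotation (Circle.exp θ)).toHomeomorph.measurableEmbedding f
  have : IsFiniteMeasure (volume.restrict (Set.uIoc 0 (2 * Real.pi))) := by
    rw [Set.uIoc_of_le Real.two_pi_pos.le]
    infer_instance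
  have hprod : MeasurePreserving (fun p : ℝ × ℂ => (p.1, (Circle.exp p.1 * p.2 : ℂ)))
      ((volume.restrict (Set.uIoc 0 (2 * Real.pi))).prod μ)
      ((volume.restrict (Set.uIoc 0 (2 * Real.pi))).prod μ) :=
    (MeasurePreserving.id _).skew_product (g := fun θ z => (Circle.exp θ * z : ℂ))
      (by unfold Function.uncurry; fun_prop) (.of_forall fun θ => (hμ (Circle.exp θ)).map_eq)
  have hint := hprod.integrable_comp_of_integrable (hf.comp_snd _)
  simp only [← circleAverage_comp_exp_mul, integral_smul]
  rw [← intervalIntegral_integral_swap (f := fun θ z => f (Circle.exp θ * z)) hint]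
  simp only [hrot, intervalIntegral.integral_const, sub_zero, inv_smul_smul₀ Real.two_pi_pos.ne']

theorem integral_eq_measureReal_smul_apply_zero {F : Type*} [NormedAddCommGroup F]
    [NormedSpace ℂ F] [CompleteSpace F] {μ : Measure ℂ} [SFinite μ]
    (hμ : ∀ a : Circle, MeasurePreserving (rotation a) μ μ) {f : ℂ → F} (hd : Differentiable ℂ f)
    (hi : Integrable f μ) : ∫ z, f z ∂μ = μ.real Set.univ • f 0 := by
  rw [← integral_circleAverage_norm hμ hi]
  simp [hd.diffContOnCl.circleAverage]

end MeanValue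

section FockMeasure

variable {E : Type*} [NormedAddCommGroup E] [NormedSpace ℝ E]

theorem integral_fockMeasure (f : ℂ → E) :
    ∫ z, f z ∂fockMeasure = ∫ z, (Real.pi⁻¹ * Real.exp (-‖z‖ ^ 2)) • f z :=
  integral_withDensity_eq_integral_toReal_smul (by fun_prop) (by simp) f |>.trans <|
    integral_congr_ae <| .of_forall fun z => by
      simp only [ENNReal.toReal_ofReal (show 0 ≤ Real.pi⁻¹ * Real.exp (-‖z‖ ^ 2) by positivity)]

theorem integrable_fockMeasure_iff {f : ℂ → E} :
    Integrable f fockMeasure ↔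
      Integrable fun z => (Real.pi⁻¹ * Real.exp (-‖z‖ ^ 2)) • f z :=
  integrable_withDensity_iff_integrable_smul' (by fun_prop) (by simp) |>.trans <|
    integrable_congr <| .of_forall fun z => by
      simp only [ENNReal.toReal_ofReal (show 0 ≤ Real.pi⁻¹ * Real.exp (-‖z‖ ^ 2) by positivity)]

theorem integral_exp_neg_norm_sq : ∫ z : ℂ, Real.exp (-‖z‖ ^ 2) = Real.pi := by
  simpa using GaussianFourier.integral_rexp_neg_mul_sq_norm (V := ℂ) one_pos

instance : IsProbabilityMeasure fockMeasure := by
  have hi : Integrable fun z : ℂ => Real.exp (-‖z‖ ^ 2) :=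
    .of_integral_ne_zero (integral_exp_neg_norm_sq ▸ Real.pi_ne_zero)
  refine ⟨?_⟩
  rw [fockMeasure, withDensity_apply _ .univ, Measure.restrict_univ,
    ← ofReal_integral_eq_lintegral_ofReal (hi.const_mul _) (.of_forall fun z => by positivity),
    integral_const_mul, integral_exp_neg_norm_sq, inv_mul_cancel₀ Real.pi_ne_zero,
    ENNReal.ofReal_one]

theorem measurePreserving_rotation_fockMeasure (a : Circle) :
    MeasurePreserving (rotation a) fockMeasure fockMeasure := by
  have hm := (rotation a).continuous.measurable
  refine ⟨hm, Measure.ext fun s hs => ?_⟩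
  rw [Measure.map_apply hm hs, fockMeasure, withDensity_apply _ (hm hs), withDensity_apply _ hs,
    ← (rotation a).measurePreserving.setLIntegral_comp_preimage hs (by fun_prop)]
  simp only [LinearIsometryEquiv.norm_map]

theorem integral_fockMeasure_eq_apply_zero {F : Type*} [NormedAddCommGroup F] [NormedSpace ℂ F]
    [CompleteSpace F] {f : ℂ → F} (hd : Differentiable ℂ f) (hi : Integrable f fockMeasure) :
    ∫ z, f z ∂fockMeasure = f 0 := by
  simpa using integral_eq_measureReal_smul_apply_zero measurePreserving_rotation_fockMeasure hd hi

theorem exp_neg_norm_add_sq_mul_conj_exp (z w : ℂ) :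
    (Real.exp (-‖z + w‖ ^ 2) : ℂ) * conj (Complex.exp ((z + w) * conj w)) =
      Real.exp (-‖z‖ ^ 2) * Complex.exp (-z * conj w) := by
  rw [← Complex.exp_conj]
  push_cast
  rw [← Complex.conj_mul', ← Complex.conj_mul', ← Complex.exp_add, ← Complex.exp_add]
  congr 1
  simp only [map_add, map_mul, Complex.conj_conj]
  ring

theorem integral_conj_exp_mul_fockMeasure {f : ℂ → ℂ} (hf : Differentiable ℂ f) (w : ℂ)
    (hi : Integrable (fun z => conj (Complex.exp (z * conj w)) * f z) fockMeasure) :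
    ∫ z, conj (Complex.exp (z * conj w)) * f z ∂fockMeasure = f w := by
  have h_translate (z : ℂ) : (Real.pi⁻¹ * Real.exp (-‖z + w‖ ^ 2)) •
        (conj (Complex.exp ((z + w) * conj w)) * f (z + w)) =
      (Real.pi⁻¹ * Real.exp (-‖z‖ ^ 2)) • (Complex.exp (-z * conj w) * f (z + w)) := by
    simp only [Complex.real_smul, Complex.ofReal_mul]
    linear_combination
      ((Real.pi⁻¹ : ℝ) : ℂ) * f (z + w) * exp_neg_norm_add_sq_mul_conj_exp z w
  have hi' : Integrable (fun z => Complex.exp (-z * conj w) * f (z + w)) fockMeasure := by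
    rw [integrable_fockMeasure_iff] at hi ⊢
    exact (hi.comp_add_right w).congr (.of_forall h_translate)
  calc ∫ z, conj (Complex.exp (z * conj w)) * f z ∂fockMeasure
      = ∫ z, (Real.pi⁻¹ * Real.exp (-‖z + w‖ ^ 2)) •
          (conj (Complex.exp ((z + w) * conj w)) * f (z + w)) := by
        rw [integral_fockMeasure, ← integral_add_right_eq_self _ w]
    _ = ∫ z, Complex.exp (-z * conj w) * f (z + w) ∂fockMeasure := by
        simp only [h_translate, integral_fockMeasure]
    _ = f w := by
        rw [integral_fockMeasure_eq_apply_zero (by fun_prop) hi']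
        simp

theorem memLp_exp_mul_conj_fockMeasure (w : ℂ) :
    MemLp (fun z => Complex.exp (z * conj w)) 2 fockMeasure := by
  rw [memLp_fockMeasure_iff (by fun_prop)]
  have h := (GaussianFourier.integrable_cexp_neg_mul_sq_norm_add (V := ℂ) (b := 1) (by simp)
    2 w).norm.const_mul Real.pi⁻¹
  refine h.congr (.of_forall fun z => ?_)
  simp only [Complex.norm_exp]
  rw [← Real.exp_nat_mul, mul_left_comm, ← Real.exp_add]
  congr 2
  simp only [Complex.inner, ← Complex.ofReal_pow, Complex.add_re, Complex.neg_re, Complex.mul_re,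
    Complex.one_re, Complex.ofReal_re, Complex.ofReal_im, Complex.conj_re, Complex.conj_im,
    Complex.re_ofNat, Complex.im_ofNat]
  ring

end FockMeasure

namespace FockSpace

/-- The reproducing kernel `K_w(z) = exp (z * conj w)` of Fock space at the point `w`. -/
noncomputable def reproducingKernel (w : ℂ) : FockSpace :=
  mk (fun z => Complex.exp (z * conj w)) (by fun_prop) (memLp_exp_mul_conj_fockMeasure w)

theorem reproducingKernel_apply (w z : ℂ) :
    reproducingKernel w z = Complex.exp (z * conj w) := rfl

theorem inner_reproducingKernel (w : ℂ) (f : FockSpace) :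
    ⟪reproducingKernel w, f⟫_ℂ = f w := by
  have hi := integrable_conj_mul (reproducingKernel w) f
  simp only [reproducingKernel_apply] at hi
  simp only [inner_def, reproducingKernel_apply]
  exact integral_conj_exp_mul_fockMeasure f.differentiable w hi

theorem eq_zero_of_inner_reproducingKernel {f : FockSpace}
    (h : ∀ w, ⟪reproducingKernel w, f⟫_ℂ = 0) : f = 0 :=
  DFunLike.ext _ _ fun w => (inner_reproducingKernel w f).symm.trans (h w)

theorem norm_reproducingKernel_sq (w : ℂ) : ‖reproducingKernel w‖ ^ 2 = Real.exp (‖w‖ ^ 2) := by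
  rw [← Complex.ofReal_inj, Complex.ofReal_pow]
  refine (inner_self_eq_norm_sq_to_K (𝕜 := ℂ) (reproducingKernel w)).symm.trans ?_
  rw [inner_reproducingKernel, reproducingKernel_apply, Complex.mul_conj']
  norm_cast

theorem norm_apply_le (f : FockSpace) (w : ℂ) : ‖f w‖ ≤ Real.exp (‖w‖ ^ 2 / 2) * ‖f‖ := by
  have h : ‖reproducingKernel w‖ = Real.exp (‖w‖ ^ 2 / 2) := by
    rw [← sq_eq_sq₀ (norm_nonneg _) (Real.exp_pos _).le, norm_reproducingKernel_sq,
      ← Real.exp_nat_mul]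
    congr 1
    push_cast
    ring
  rw [← h, ← inner_reproducingKernel]
  exact norm_inner_le_norm _ _

theorem enorm_eq_eLpNorm (f : FockSpace) : ‖f‖ₑ = eLpNorm f 2 fockMeasure := by
  have h : ⟪f, f⟫_ℂ = ⟪f.memLp.toLp f, f.memLp.toLp f⟫_ℂ := by
    rw [inner_def, L2.inner_def]
    refine integral_congr_ae ?_
    filter_upwards [f.memLp.coeFn_toLp] with z hz
    rw [hz, RCLike.inner_apply']
  rw [← Lp.enorm_toLp (hf := f.memLp), ← ofReal_norm, ← ofReal_norm,
    norm_eq_sqrt_re_inner (𝕜 := ℂ), norm_eq_sqrt_re_inner (𝕜 := ℂ), h]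

theorem uniformCauchySeqOn_ball {u : ℕ → FockSpace} (hu : CauchySeq u) (R : ℝ) :
    UniformCauchySeqOn (fun n => u n) atTop (ball 0 R) := by
  rw [Metric.uniformCauchySeqOn_iff]
  intro ε hε
  obtain ⟨N, hN⟩ := Metric.cauchySeq_iff.1 hu (ε / Real.exp (R ^ 2 / 2)) (by positivity)
  refine ⟨N, fun m hm n hn z hz => ?_⟩
  have hz : ‖z‖ < R := by simpa using hz
  calc dist (u m z) (u n z) = ‖(u m - u n) z‖ := dist_eq_norm _ _
    _ ≤ Real.exp (‖z‖ ^ 2 / 2) * ‖u m - u n‖ := norm_apply_le _ _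
    _ ≤ Real.exp (R ^ 2 / 2) * ‖u m - u n‖ := by gcongr
    _ < ε := by
      rw [← lt_div_iff₀' (Real.exp_pos _), ← dist_eq_norm]
      exact hN m hm n hn

theorem exists_differentiable_forall_tendsto {u : ℕ → FockSpace} (hu : CauchySeq u) :
    ∃ g : ℂ → ℂ, Differentiable ℂ g ∧ ∀ z, Tendsto (fun n => u n z) atTop (𝓝 (g z)) := by
  have h_mem (z : ℂ) : z ∈ ball (0 : ℂ) (‖z‖ + 1) := by simp
  choose g hg using fun z =>
    cauchySeq_tendsto_of_complete ((uniformCauchySeqOn_ball hu (‖z‖ + 1)).cauchySeq (h_mem z))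
  refine ⟨g, fun z => ?_, hg⟩
  have h_unif := (uniformCauchySeqOn_ball hu (‖z‖ + 1)).tendstoUniformlyOn_of_tendsto
    fun w _ => hg w
  exact (h_unif.tendstoLocallyUniformlyOn.differentiableOn
    (.of_forall fun n => (u n).differentiable.differentiableOn) isOpen_ball).differentiableAt
    (isOpen_ball.mem_nhds (h_mem z))

theorem edist_eq_eLpNorm (f g : FockSpace) : edist f g = eLpNorm (⇑f - ⇑g) 2 fockMeasure := by
  rw [edist_eq_enorm_sub, enorm_eq_eLpNorm]
  rfl

instance : CompleteSpace FockSpace := by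
  refine EMetric.complete_of_convergent_controlled_sequences (fun n => 2⁻¹ ^ n)
    (ENNReal.pow_pos (by simp)) fun u hu => ?_
  have h_cauchy : CauchySeq u := EMetric.cauchySeq_iff_le_tendsto_0.2
    ⟨fun n => 2⁻¹ ^ n, fun n m N hn hm => (hu N n m hn hm).le,
      ENNReal.tendsto_pow_atTop_nhds_zero_of_lt_one (by simp)⟩
  obtain ⟨g, hgd, hg⟩ := exists_differentiable_forall_tendsto h_cauchy
  simp only [edist_eq_eLpNorm] at hu
  have h_lim : Tendsto (fun n => eLpNorm (⇑(u n) - g) 2 fockMeasure) atTop (𝓝 0) :=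
    Lp.cauchy_tendsto_of_tendsto (fun n => (u n).memLp.aestronglyMeasurable) g
      (by simp [ENNReal.tsum_geometric]) hu (.of_forall hg)
  have hgL : MemLp g 2 fockMeasure := Lp.memLp_of_cauchy_tendsto one_le_two
    (fun n => (u n).memLp) g hgd.continuous.aestronglyMeasurable h_lim
  refine ⟨mk g hgd hgL, tendsto_iff_edist_tendsto_0.2 ?_⟩
  simpa only [edist_eq_eLpNorm] using! h_lim

end FockSpace

section SegalBargmann

theorem segalBargmannKernel_ne_zero (z : ℂ) (x : ℝ) : segalBargmannKernel z x ≠ 0 :=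
  mul_ne_zero (Complex.ofReal_ne_zero.2 (Real.rpow_pos_of_pos Real.pi_pos _).ne')
    (Complex.exp_ne_zero _)

theorem segalBargmannKernel_neg (z : ℂ) (x : ℝ) :
    segalBargmannKernel z (-x) = segalBargmannKernel (-z) x := by
  simp [segalBargmannKernel]

theorem conj_segalBargmannKernel (z : ℂ) (x : ℝ) :
    conj (segalBargmannKernel z x) = segalBargmannKernel (conj z) x := by
  simp [segalBargmannKernel, ← Complex.exp_conj, Complex.conj_ofNat]

theorem segalBargmannKernel_neg_mul_I (ξ x : ℝ) :
    segalBargmannKernel (-(Real.sqrt 2 * Real.pi * ξ) * Complex.I) x =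
      Complex.exp ((Real.pi * ξ) ^ 2) *
        (Complex.exp (↑(-2 * Real.pi * x * ξ) * Complex.I) * segalBargmannKernel 0 x) := by
  have h2 : (Real.sqrt 2 : ℂ) ^ 2 = 2 := by simp [← Complex.ofReal_pow]
  rw [segalBargmannKernel, segalBargmannKernel, mul_left_comm _ (Complex.ofReal _),
    mul_left_comm _ (Complex.ofReal _), ← Complex.exp_add, ← Complex.exp_add]
  congr 2
  push_cast
  linear_combination (-(Real.pi * ξ : ℂ) ^ 2 * Complex.I ^ 2 / 2 - Real.pi * ξ * x * Complex.I) * h2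
    - (Real.pi * ξ : ℂ) ^ 2 * Complex.I_sq

theorem segalBargmannKernel_mul_conj (z w : ℂ) (x : ℝ) :
    segalBargmannKernel z x * conj (segalBargmannKernel w x) =
      (Real.pi ^ (-(1 / 2) : ℝ) : ℝ) * Complex.exp ((-1) * x ^ 2 +
        Real.sqrt 2 * (z + conj w) * x + (-(z ^ 2 + conj w ^ 2) / 2)) := by
  have hp : Real.pi ^ (-(1 / 2) : ℝ) = Real.pi ^ (-(1 / 4) : ℝ) * Real.pi ^ (-(1 / 4) : ℝ) := by
    rw [← Real.rpow_add Real.pi_pos]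
    norm_num
  rw [conj_segalBargmannKernel, segalBargmannKernel, segalBargmannKernel, hp, Complex.ofReal_mul,
    mul_mul_mul_comm, ← Complex.exp_add]
  congr 2
  ring

theorem integral_segalBargmannKernel_mul_conj (z w : ℂ) :
    ∫ x, segalBargmannKernel z x * conj (segalBargmannKernel w x) =
      Complex.exp (z * conj w) := by
  have h2 : (Real.sqrt 2 : ℂ) ^ 2 = 2 := by simp [← Complex.ofReal_pow]
  have hπ : ((Real.pi ^ (-(1 / 2) : ℝ) : ℝ) : ℂ) * (Real.pi / - -1 : ℂ) ^ (1 / 2 : ℂ) = 1 := by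
    have : (1 / 2 : ℂ) = ((1 / 2 : ℝ) : ℂ) := by norm_num
    rw [neg_neg, div_one, this, ← Complex.ofReal_cpow Real.pi_pos.le, ← Complex.ofReal_mul,
      ← Real.rpow_add Real.pi_pos]
    simp
  simp only [segalBargmannKernel_mul_conj]
  rw [integral_const_mul, integral_cexp_quadratic (by simp), ← mul_assoc, hπ, one_mul]
  congr 1
  linear_combination ((z + conj w) ^ 2 / 4) * h2

theorem memLp_segalBargmannKernel (z : ℂ) : MemLp (segalBargmannKernel z) 2 := by
  have hc : Continuous (segalBargmannKernel z) := by
    unfold segalBargmannKernel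
    fun_prop
  have hi : Integrable fun x => segalBargmannKernel z x * conj (segalBargmannKernel z x) := by
    simp only [segalBargmannKernel_mul_conj]
    exact (integrable_cexp_quadratic' (by simp) _ _).const_mul _
  rw [memLp_two_iff_integrable_sq_norm hc.aestronglyMeasurable]
  exact hi.norm.congr (.of_forall fun x => by simp [sq])

theorem integrable_segalBargmannKernel_mul (z : ℂ) (f : Lp ℂ 2 (volume : Measure ℝ)) :
    Integrable fun x => segalBargmannKernel z x * f x :=
  (memLp_segalBargmannKernel z).integrable_mul (Lp.memLp f)

theorem segalBargmann_neg_mul_I (f : Lp ℂ 2 (volume : Measure ℝ)) (ξ : ℝ) :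
    segalBargmann f (-(Real.sqrt 2 * Real.pi * ξ) * Complex.I) =
      Complex.exp ((Real.pi * ξ) ^ 2) * 𝓕 (fun x => segalBargmannKernel 0 x * f x) ξ := by
  rw [Real.fourier_real_eq_integral_exp_smul, ← integral_const_mul, segalBargmann]
  refine integral_congr_ae (.of_forall fun x => ?_)
  simp only [segalBargmannKernel_neg_mul_I, smul_eq_mul]
  ring

theorem eq_zero_of_segalBargmann_eq_zero {f : Lp ℂ 2 (volume : Measure ℝ)}
    (h : ∀ z, segalBargmann f z = 0) : f = 0 := by
  have h_fourier : 𝓕 (fun x => segalBargmannKernel 0 x * f x) = 0 := by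
    ext ξ
    simpa [h] using (segalBargmann_neg_mul_I f ξ).symm
  rw [Lp.eq_zero_iff_ae_eq_zero]
  filter_upwards [ae_eq_zero_of_fourier_eq_zero (integrable_segalBargmannKernel_mul 0 f) h_fourier]
    with x hx
  exact (mul_eq_zero.1 hx).resolve_left (segalBargmannKernel_ne_zero 0 x)

/-- The function `x ↦ conj (A(w, x))` as a vector of `L²(ℝ)`; it represents the evaluation of the
Segal–Bargmann transform at `w`. -/
noncomputable def segalBargmannKernelLp (w : ℂ) : Lp ℂ 2 (volume : Measure ℝ) :=
  (memLp_segalBargmannKernel w).star.toLp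

theorem segalBargmannKernelLp_ae (w : ℂ) :
    ∀ᵐ x, segalBargmannKernelLp w x = conj (segalBargmannKernel w x) :=
  (memLp_segalBargmannKernel w).star.coeFn_toLp

theorem inner_segalBargmannKernelLp (w : ℂ) (f : Lp ℂ 2 (volume : Measure ℝ)) :
    ⟪segalBargmannKernelLp w, f⟫_ℂ = segalBargmann f w := by
  rw [L2.inner_def, segalBargmann]
  refine integral_congr_ae ?_
  filter_upwards [segalBargmannKernelLp_ae w] with x hx
  rw [hx, RCLike.inner_apply', Complex.conj_conj]

theorem segalBargmann_segalBargmannKernelLp (w z : ℂ) :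
    segalBargmann (segalBargmannKernelLp w) z = Complex.exp (z * conj w) := by
  rw [segalBargmann, ← integral_segalBargmannKernel_mul_conj]
  refine integral_congr_ae ?_
  filter_upwards [segalBargmannKernelLp_ae w] with x hx
  rw [hx]

theorem inner_segalBargmannKernelLp_eq_inner_reproducingKernel (z w : ℂ) :
    ⟪segalBargmannKernelLp z, segalBargmannKernelLp w⟫_ℂ =
      ⟪FockSpace.reproducingKernel z, FockSpace.reproducingKernel w⟫_ℂ := by
  rw [inner_segalBargmannKernelLp, segalBargmann_segalBargmannKernelLp,
    FockSpace.inner_reproducingKernel, FockSpace.reproducingKernel_apply]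

theorem exists_linearIsometryEquiv_segalBargmann :
    ∃ U : Lp ℂ 2 (volume : Measure ℝ) ≃ₗᵢ[ℂ] FockSpace, ∀ f z, U f z = segalBargmann f z := by
  obtain ⟨U, hU⟩ := exists_linearIsometryEquiv_of_inner_eq (𝕜 := ℂ) (u := segalBargmannKernelLp)
    (v := FockSpace.reproducingKernel)
    (fun f hf => eq_zero_of_segalBargmann_eq_zero fun z => by
      rw [← inner_segalBargmannKernelLp, hf])
    (fun _ => FockSpace.eq_zero_of_inner_reproducingKernel)
    inner_segalBargmannKernelLp_eq_inner_reproducingKernel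
  refine ⟨U, fun f z => ?_⟩
  rw [← FockSpace.inner_reproducingKernel, ← hU, U.inner_map_map, inner_segalBargmannKernelLp]

theorem segalBargmann_timeReversal (f : Lp ℂ 2 (volume : Measure ℝ)) (z : ℂ) :
    segalBargmann (timeReversal f) z = conj (segalBargmann f (conj z)) := by
  rw [segalBargmann, segalBargmann, ← integral_conj]
  refine integral_congr_ae ?_
  filter_upwards [timeReversal_ae f] with x hx
  rw [hx, map_mul, conj_segalBargmannKernel, Complex.conj_conj]

theorem segalBargmann_parityTime (f : Lp ℂ 2 (volume : Measure ℝ)) (z : ℂ) :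
    segalBargmann (parityTime f) z = conj (segalBargmann f (conj (-z))) := by
  rw [segalBargmann, segalBargmann, ← integral_conj, ← integral_neg_eq_self]
  refine integral_congr_ae ?_
  filter_upwards [(Measure.measurePreserving_neg volume).quasiMeasurePreserving.ae
    (parityTime_ae f)] with x hx
  rw [hx, neg_neg, map_mul, conj_segalBargmannKernel, Complex.conj_conj, segalBargmannKernel_neg]

end SegalBargmann

theorem proposition5p5 :
    ∃ U : Lp ℂ 2 (volume : Measure ℝ) ≃ₗᵢ[ℂ] FockSpace,
      (∀ f : Lp ℂ 2 (volume : Measure ℝ), ∀ z : ℂ, U f z = segalBargmann f z) ∧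
      (∀ g : FockSpace,
        U (timeReversal (U.symm g)) = weightedCompConj 1 0 1 isConjugationParam_one g) ∧
      (∀ g : FockSpace,
        U (parityTime (U.symm g)) = weightedCompConj (-1) 0 1 isConjugationParam_neg_one g) := by
  obtain ⟨U, hU⟩ := exists_linearIsometryEquiv_segalBargmann
  refine ⟨U, hU, fun g => DFunLike.ext _ _ fun z => ?_, fun g => DFunLike.ext _ _ fun z => ?_⟩
  · rw [hU, segalBargmann_timeReversal, ← hU, U.apply_symm_apply, weightedCompConj_apply]
    simp
  · rw [hU, segalBargmann_parityTime, ← hU, U.apply_symm_apply, weightedCompConj_apply]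
    simp
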